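/- Let $\lambda,\omega\in\mathbb{R}$, let $m$ be a nonzero integer, and let $a\in\mathbb{R}$, $a\neq 0$. Let $h:[0,\infty)\to\mathbb{R}$ be $|m|$ times differentiable on $[0,\infty)$ (with one-sided derivatives at $0$) and twice differentiable on $(0,\infty)$, and suppose that $$h''(r)+\frac{1}{r}h'(r)-\frac{m^2}{r^2}\sin h(r)\cos h(r)=\lambda\sin h(r)\cos h(r)+\omega\sin h(r)\qquad (r>0),$$ $$h(0)=0,\qquad h^{(|m|)}(0)=a,\qquad \lim_{r\to\infty}h(r)=k\pi\ \text{ for some } k\in\mathbb{Z},$$ and that $h$ has finite energy, that is, $$\int_0^\infty\Big(h'(r)^2+\frac{m^2}{r^2}\sin^2 h(r)\Big)\,r\,dr<\infty .$$ Then exactly one of the following five cases holds: (i) $\lambda=\omega=0$ and $h(r)=2\arctan\big(\frac{a}{2\,|m|!}\,r^{|m|}\big)$ for all $r\ge 0$; (ii) $\lambda=\omega\neq 0$ and $h(r)\to(2l+1)\pi$ as $r\to\infty$ for some $l\in\mathbb{Z}$; (iii) $\lambda=-\omega\neq 0$ and $h(r)\to 2l\pi$ as $r\to\infty$ for some $l\in\mathbb{Z}$;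 (iv) $0<\omega<\lambda$ and $h(r)$ converges exponentially to $(2l+1)\pi$ as $r\to\infty$ for some $l\in\mathbb{Z}$; (v) $-\lambda<\omega<0$ and $h(r)$ converges exponentially to $2l\pi$ as $r\to\infty$ for some $l\in\mathbb{Z}$. Here $h(r)$ converges exponentially to $L$ as $r\to\infty$ if there are $C,\varepsilon>0$ and $R\in\mathbb{R}$ with $|h(r)-L|\le Ce^{-\varepsilon r}$ for all $r\ge R$. -/

import Mathlib

open Set Filter Topology MeasureTheory

/-- `h : [0, ∞) → ℝ` (only the values on `[0, ∞)` matter) solves the singular initial value problem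
`h'' + h'/r - (m²/r²) sin h cos h = lam sin h cos h + om sin h` on `(0, ∞)`,
`h(0) = 0`, `h^{(|m|)}(0) = a`. Derivatives at the endpoint `0` are one-sided. -/
structure IsIVPSolution (lam om : ℝ) (m : ℤ) (a : ℝ) (h : ℝ → ℝ) : Prop where
  /-- `h` is twice differentiable on `(0, ∞)`. -/
  differentiableAt : ∀ r : ℝ, 0 < r → DifferentiableAt ℝ h r
  differentiableAt_deriv : ∀ r : ℝ, 0 < r → DifferentiableAt ℝ (deriv h) r
  ode : ∀ r : ℝ, 0 < r →
    deriv (deriv h) r + deriv h r / r - (m : ℝ) ^ 2 / r ^ 2 * (Real.sin (h r) * Real.cos (h r))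
      = lam * (Real.sin (h r) * Real.cos (h r)) + om * Real.sin (h r)
  /-- `h` is `|m|` times differentiable on `[0, ∞)`, so that `h^{(|m|)}(0)` makes sense. -/
  differentiableOn_iteratedDerivWithin : ∀ j : ℕ, j < m.natAbs →
    DifferentiableOn ℝ (iteratedDerivWithin j h (Ici 0)) (Ici 0)
  initial_zero : h 0 = 0
  initial_deriv : iteratedDerivWithin m.natAbs h (Ici 0) 0 = a

/-- A vortex solution: a solution of the initial value problem that tends to an integer multiple
of `π` at infinity. -/
structure IsVortexSolution (lam om : ℝ) (m : ℤ) (a : ℝ) (h : ℝ → ℝ) : Prop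
    extends IsIVPSolution lam om m a h where
  limit : ∃ k : ℤ, Tendsto h atTop (𝓝 (k * Real.pi))

/-- The energy `∫₀^∞ (h'² + (m²/r²) sin² h) r dr` is finite. -/
def HasFiniteEnergy (m : ℤ) (h : ℝ → ℝ) : Prop :=
  IntegrableOn
    (fun r : ℝ => ((deriv h r) ^ 2 + (m : ℝ) ^ 2 / r ^ 2 * (Real.sin (h r)) ^ 2) * r) (Ioi 0)

/-- `h(r)` converges to `L` exponentially as `r → ∞`. -/
def ConvergesExponentially (h : ℝ → ℝ) (L : ℝ) : Prop :=
  ∃ C ε R : ℝ, 0 < C ∧ 0 < ε ∧ ∀ r : ℝ, R ≤ r → |h r - L| ≤ C * Real.exp (-ε * r)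

/-! Put `u = h - kπ` and `b = cos(kπ) om = ±om`, the sign being the parity of `k`. Then `u → 0`, and
near infinity the equation linearises to `u'' + u'/r = (lam + b) u`, so everything depends on the
sign of `lam + b`.

If `lam + b < 0`, finite energy forces `u` and `u'` to vanish together at some radius
(`exists_cauchy_data_eq_zero`). By uniqueness `h` is then constant, which `a ≠ 0` forbids. If `lam +
b > 0`, `u` decays exponentially (`exists_sq_le_exp`). The Pohozaev functional then tends to `0`
along sequences approaching both ends of `(0, ∞)`, and its monotonicity for `b ≥ 0` would make `h`
constant (`sin_eq_zero`); hence `b < 0`. If `lam + b = 0`, either both parameters vanish, and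
equipartition `(r h')² = m² sin² h` integrates to the arctangent profile, or the parity of `k`
selects (ii) or (iii). -/

/-! ### Monotonicity tools and logarithmic divergence. -/

theorem le_of_hasDerivAt_nonneg {f f' : ℝ → ℝ} {a b : ℝ} (hab : a ≤ b)
    (hf : ∀ x, a ≤ x → x ≤ b → HasDerivAt f (f' x) x) (h : ∀ x, a ≤ x → x ≤ b → 0 ≤ f' x) :
    f a ≤ f b := by
  have hm : MonotoneOn f (Icc a b) := by
    refine monotoneOn_of_deriv_nonneg (convex_Icc a b)
      (fun x hx => (hf x hx.1 hx.2).continuousAt.continuousWithinAt) ?_ ?_ <;>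
      rw [interior_Icc] <;> intro x hx
    · exact (hf x hx.1.le hx.2.le).differentiableAt.differentiableWithinAt
    · rw [(hf x hx.1.le hx.2.le).deriv]
      exact h x hx.1.le hx.2.le
  exact hm (left_mem_Icc.2 hab) (right_mem_Icc.2 hab) hab

theorem le_of_hasDerivAt_nonpos {f f' : ℝ → ℝ} {a b : ℝ} (hab : a ≤ b)
    (hf : ∀ x, a ≤ x → x ≤ b → HasDerivAt f (f' x) x) (h : ∀ x, a ≤ x → x ≤ b → f' x ≤ 0) :
    f b ≤ f a := by
  have := le_of_hasDerivAt_nonneg (f := fun x => -f x) (f' := fun x => -f' x) hab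
    (fun x h1 h2 => (hf x h1 h2).neg) (fun x h1 h2 => neg_nonneg.2 (h x h1 h2))
  linarith

theorem eq_of_hasDerivAt_zero_of_pos {f : ℝ → ℝ} (hf : ∀ x, 0 < x → HasDerivAt f 0 x)
    {x y : ℝ} (hx : 0 < x) (hy : 0 < y) : f x = f y := by
  wlog hxy : x ≤ y generalizing x y
  · exact (this hy hx (le_of_not_ge hxy)).symm
  refine le_antisymm ?_ ?_
  · exact le_of_hasDerivAt_nonneg (f' := fun _ => 0) hxy
      (fun z h1 _ => hf z (hx.trans_le h1)) (fun _ _ _ => le_rfl)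
  · exact le_of_hasDerivAt_nonpos (f' := fun _ => 0) hxy
      (fun z h1 _ => hf z (hx.trans_le h1)) (fun _ _ _ => le_rfl)

/-- A function bounded above on `(0, ∞)` has `r * F' r` arbitrarily small for large `r`. -/
theorem exists_ge_mul_deriv_lt {F e : ℝ → ℝ} {K : ℝ} (hF : ∀ r, 0 < r → HasDerivAt F (e r) r)
    (hK : ∀ r, 0 < r → F r ≤ K) {ε : ℝ} (hε : 0 < ε) (R : ℝ) :
    ∃ r, R ≤ r ∧ 0 < r ∧ r * e r < ε := by
  by_contra! hcon
  set S := max R 1 with hS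
  have hS0 : 0 < S := lt_of_lt_of_le one_pos (le_max_right _ _)
  obtain ⟨r, hr1, hr2⟩ := ((Real.tendsto_log_atTop.eventually_gt_atTop
    ((K - F S) / ε + Real.log S)).and (eventually_ge_atTop S)).exists
  -- If `x F'(x) ≥ ε` from `S` on, `F` grows at least like `ε log`, against its bound.
  have hmono := le_of_hasDerivAt_nonneg (f := fun x => F x - ε * Real.log x)
    (f' := fun x => e x - ε * x⁻¹) hr2
    (fun x h1 _ => (hF x (hS0.trans_le h1)).sub
      ((Real.hasDerivAt_log (hS0.trans_le h1).ne').const_mul ε))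
    (fun x h1 _ => by
      have hx : 0 < x := hS0.trans_le h1
      have := hcon x ((le_max_left _ _).trans h1) hx
      rw [sub_nonneg, ← div_eq_mul_inv, div_le_iff₀ hx]
      linarith)
  have h2 := hK r (hS0.trans_le hr2)
  have h3 : (K - F S) / ε < Real.log r - Real.log S := by linarith
  rw [div_lt_iff₀ hε] at h3
  nlinarith

/-- A function bounded below on `(0, ∞)` has `r * F' r` arbitrarily small for small `r`. -/
theorem exists_le_mul_deriv_lt {F e : ℝ → ℝ} {K : ℝ} (hF : ∀ r, 0 < r → HasDerivAt F (e r) r)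
    (hK : ∀ r, 0 < r → K ≤ F r) {ε : ℝ} (hε : 0 < ε) {δ : ℝ} (hδ : 0 < δ) :
    ∃ r, r ≤ δ ∧ 0 < r ∧ r * e r < ε := by
  by_contra! hcon
  obtain ⟨r, hr1, hr2, hr3⟩ := ((Real.tendsto_log_nhdsGT_zero.eventually_lt_atBot
    ((K - F δ) / ε + Real.log δ)).and (Ioc_mem_nhdsGT hδ)).exists
  have hmono := le_of_hasDerivAt_nonneg (f := fun x => F x - ε * Real.log x)
    (f' := fun x => e x - ε * x⁻¹) hr3
    (fun x h1 _ => (hF x (hr2.trans_le h1)).sub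
      ((Real.hasDerivAt_log (hr2.trans_le h1).ne').const_mul ε))
    (fun x h1 h2 => by
      have hx : 0 < x := hr2.trans_le h1
      have := hcon x h2 hx
      rw [sub_nonneg, ← div_eq_mul_inv, div_le_iff₀ hx]
      linarith)
  have h2 := hK r hr2
  have h3 : Real.log r - Real.log δ < (K - F δ) / ε := by linarith
  rw [lt_div_iff₀ hε] at h3
  nlinarith

/-! ### Radial profiles, the Pohozaev functional, Cauchy uniqueness. -/

/-- A radial profile `u` with derivative `p` solving
`u'' + u'/r = ((M/r² + lam) cos u + b) sin u` on `(0, ∞)`, together with a bounded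
antiderivative `F` of its energy density. -/
structure RadialProfile (lam b M : ℝ) (u p F : ℝ → ℝ) : Prop where
  nonneg : 0 ≤ M
  hasDerivAt : ∀ r, 0 < r → HasDerivAt u (p r) r
  hasDerivAt_deriv : ∀ r, 0 < r → HasDerivAt p
    (-(p r / r) + ((M / r ^ 2 + lam) * Real.cos (u r) + b) * Real.sin (u r)) r
  hasDerivAt_energy : ∀ r, 0 < r →
    HasDerivAt F ((p r ^ 2 + M / r ^ 2 * Real.sin (u r) ^ 2) * r) r
  energy_bounded : ∃ K, ∀ r, 0 < r → 0 ≤ F r ∧ F r ≤ K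

/-- The potential `G` with `G' = (lam cos u + b) sin u` and `G 0 = 0`. -/
noncomputable def vortexPotential (lam b x : ℝ) : ℝ :=
  (1 - Real.cos x) * (lam / 2 * (1 + Real.cos x) + b)

/-- The Pohozaev functional `(r u')² - M sin² u - 2 r² G(u)`. -/
noncomputable def pohozaev (lam b M : ℝ) (u p : ℝ → ℝ) (r : ℝ) : ℝ :=
  (r * p r) ^ 2 - M * Real.sin (u r) ^ 2 - 2 * r ^ 2 * vortexPotential lam b (u r)

namespace RadialProfile

variable {lam b M : ℝ} {u p F : ℝ → ℝ}

theorem hasDerivAt_pohozaev (H : RadialProfile lam b M u p F) {r : ℝ} (hr : 0 < r) :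
    HasDerivAt (pohozaev lam b M u p) (-4 * r * vortexPotential lam b (u r)) r := by
  have hu := H.hasDerivAt r hr
  have hp := H.hasDerivAt_deriv r hr
  have hc := hu.cos
  have hs := hu.sin
  have hid := hasDerivAt_id r
  have hG := (hc.const_sub 1).mul (((hc.const_add 1).const_mul (lam / 2)).add_const b)
  have := (((hid.mul hp).pow 2).sub ((hs.pow 2).const_mul M)).sub
    (((hid.pow 2).const_mul 2).mul hG)
  refine HasDerivAt.congr_deriv (this.congr_of_eventuallyEq (Eventually.of_forall fun x => ?_)) ?_
  · simp [pohozaev, vortexPotential]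
  · simp [vortexPotential]
    field_simp
    ring

/-- Vanishing Cauchy data at one radius forces the profile to vanish. -/
theorem eq_zero_of_cauchy_data (H : RadialProfile lam b M u p F) {r₀ : ℝ} (hr₀ : 0 < r₀)
    (hu0 : u r₀ = 0) (hp0 : p r₀ = 0) {r : ℝ} (hr : 0 < r) : u r = 0 := by
  -- Grönwall for `u² + p²` in either direction; staying on `[s, ∞)` keeps the singular coefficients
  -- `1/x` and `M/x²` bounded.
  set s := min r r₀ with hs
  have hs0 : 0 < s := lt_min hr hr₀
  set A := M / s ^ 2 + |lam| + |b| with hA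
  have hA0 : 0 ≤ A := by have := H.nonneg; positivity
  set N : ℝ → ℝ := fun x => u x ^ 2 + p x ^ 2 with hN
  set N' : ℝ → ℝ := fun x => 2 * u x * p x + 2 * p x *
    (-(p x / x) + ((M / x ^ 2 + lam) * Real.cos (u x) + b) * Real.sin (u x)) with hN'
  set L := 1 + A + 2 / s with hL
  have hd : ∀ x, s ≤ x → HasDerivAt N (N' x) x := fun x hx => by
    have hx0 := hs0.trans_le hx
    refine (((H.hasDerivAt x hx0).pow 2).add ((H.hasDerivAt_deriv x hx0).pow 2)).congr_deriv ?_
    simp [hN']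
  have hb : ∀ x, s ≤ x → |N' x| ≤ L * N x := fun x hx => by
    have hx0 := hs0.trans_le hx
    have hq : |((M / x ^ 2 + lam) * Real.cos (u x) + b) * Real.sin (u x)| ≤ A * |u x| := by
      rw [abs_mul]
      refine mul_le_mul ?_ Real.abs_sin_le_abs (abs_nonneg _) hA0
      have h1 : |(M / x ^ 2 + lam) * Real.cos (u x)| ≤ M / s ^ 2 + |lam| := by
        rw [abs_mul]
        have h2 : |M / x ^ 2 + lam| ≤ M / s ^ 2 + |lam| := by
          refine (abs_add_le _ _).trans ?_
          gcongr
          rw [abs_of_nonneg (div_nonneg H.nonneg (sq_nonneg x))]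
          exact div_le_div_of_nonneg_left H.nonneg (by positivity) (by gcongr)
        calc _ ≤ |M / x ^ 2 + lam| * 1 := by gcongr; exact Real.abs_cos_le_one _
          _ ≤ _ := by linarith
      exact (abs_add_le _ _).trans (by linarith)
    have hinv : 1 / x ≤ 1 / s := one_div_le_one_div_of_le hs0 hx
    have hup : 2 * (|u x| * |p x|) ≤ N x := by
      have := sq_nonneg (|u x| - |p x|)
      simp only [hN]
      nlinarith [sq_abs (u x), sq_abs (p x)]
    have hpN : p x ^ 2 ≤ N x := by simp only [hN]; nlinarith [sq_nonneg (u x)]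
    have e1 : |2 * u x * p x| = 2 * (|u x| * |p x|) := by
      rw [abs_mul, abs_mul, abs_of_pos (two_pos : (0 : ℝ) < 2)]; ring
    have e2 : |2 * p x * -(p x / x)| ≤ 2 / s * N x := by
      have : 2 * p x * -(p x / x) = -(2 * (1 / x) * p x ^ 2) := by ring
      rw [this, abs_neg, abs_of_nonneg (by positivity)]
      calc 2 * (1 / x) * p x ^ 2 ≤ 2 * (1 / s) * N x := by gcongr
        _ = _ := by ring
    have e3 : |2 * p x * (((M / x ^ 2 + lam) * Real.cos (u x) + b) * Real.sin (u x))|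
        ≤ A * N x := by
      rw [abs_mul, abs_mul, abs_of_pos (two_pos : (0 : ℝ) < 2)]
      calc _ ≤ 2 * |p x| * (A * |u x|) := by gcongr
        _ = A * (2 * (|u x| * |p x|)) := by ring
        _ ≤ _ := by gcongr
    have : N' x = 2 * u x * p x + 2 * p x * -(p x / x) +
        2 * p x * (((M / x ^ 2 + lam) * Real.cos (u x) + b) * Real.sin (u x)) := by
      simp only [hN']; ring
    rw [this]
    refine (abs_add_three _ _ _).trans ?_
    simp only [hL]
    nlinarith
  have hNr₀ : N r₀ = 0 := by simp [hN, hu0, hp0]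
  have hexp : ∀ c x : ℝ, HasDerivAt (fun x => Real.exp (c * x)) (Real.exp (c * x) * c) x :=
    fun c x => by simpa using ((hasDerivAt_id x).const_mul c).exp
  have hNr : N r ≤ 0 := by
    rcases le_total r r₀ with hle | hle
    · have hsr : s = r := min_eq_left hle
      have := le_of_hasDerivAt_nonneg (f := fun x => N x * Real.exp (L * x)) hle
        (fun x h1 _ => (hd x (hsr ▸ h1)).mul (hexp L x)) (fun x h1 _ => by
          have h2 := (abs_le.1 (hb x (hsr ▸ h1))).1
          have h3 := Real.exp_pos (L * x)
          nlinarith)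
      simp only [hNr₀, zero_mul] at this
      exact nonpos_of_mul_nonpos_left this (Real.exp_pos _)
    · have hsr : s = r₀ := min_eq_right hle
      have := le_of_hasDerivAt_nonpos (f := fun x => N x * Real.exp (-L * x)) hle
        (fun x h1 _ => (hd x (hsr ▸ h1)).mul (hexp (-L) x)) (fun x h1 _ => by
          have h2 := (abs_le.1 (hb x (hsr ▸ h1))).2
          have h3 := Real.exp_pos (-L * x)
          nlinarith)
      simp only [hNr₀, zero_mul] at this
      exact nonpos_of_mul_nonpos_left this (Real.exp_pos _)
  have h4 : u r ^ 2 ≤ 0 := by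
    have : N r = u r ^ 2 + p r ^ 2 := rfl
    nlinarith [sq_nonneg (p r)]
  exact pow_eq_zero_iff (two_ne_zero) |>.1 (le_antisymm h4 (sq_nonneg _))

end RadialProfile

theorem sin_sq_le_mul_sin {x : ℝ} (hx : |x| ≤ 1) : Real.sin x ^ 2 ≤ x * Real.sin x := by
  wlog h0 : 0 ≤ x generalizing x
  · have := this (x := -x) (by rwa [abs_neg]) (by linarith)
    simpa using this
  have h1 := Real.sin_le h0
  have h2 := Real.sin_nonneg_of_nonneg_of_le_pi h0
    (by linarith [(abs_le.1 hx).2, Real.pi_gt_three])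
  nlinarith

theorem half_sq_le_mul_sin {x : ℝ} (hx : |x| ≤ 1) : x ^ 2 / 2 ≤ x * Real.sin x := by
  wlog h0 : 0 ≤ x generalizing x
  · have := this (x := -x) (by rwa [abs_neg]) (by linarith)
    simpa using this
  have h1 := Real.mul_le_sin h0 (by linarith [(abs_le.1 hx).2, Real.pi_gt_three])
  have h2 : 1 / 2 ≤ 2 / Real.pi := by
    rw [div_le_div_iff₀ two_pos Real.pi_pos]
    linarith [Real.pi_le_four]
  have h3 : 1 / 2 * x ≤ Real.sin x := (mul_le_mul_of_nonneg_right h2 h0).trans h1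
  nlinarith

/-! ### Behaviour at infinity according to the sign of `lam + b`. -/

namespace RadialProfile

variable {lam b M : ℝ} {u p F : ℝ → ℝ}

theorem tendsto_coefficient (lam b M : ℝ) (hu : Tendsto u atTop (𝓝 0)) :
    Tendsto (fun r => (M / r ^ 2 + lam) * Real.cos (u r) + b) atTop (𝓝 (lam + b)) := by
  have h1 : Tendsto (fun r : ℝ => M / r ^ 2) atTop (𝓝 0) :=
    tendsto_const_nhds.div_atTop (tendsto_pow_atTop two_ne_zero)
  have h2 : Tendsto (fun r => Real.cos (u r)) atTop (𝓝 1) := by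
    simpa [Function.comp_def] using (Real.continuous_cos.tendsto 0).comp hu
  simpa using ((h1.add_const lam).mul h2).add_const b

theorem tendsto_potential_factor (lam b : ℝ) (hu : Tendsto u atTop (𝓝 0)) :
    Tendsto (fun r => lam / 2 * (1 + Real.cos (u r)) + b) atTop (𝓝 (lam + b)) := by
  have h2 : Tendsto (fun r => Real.cos (u r)) atTop (𝓝 1) := by
    simpa [Function.comp_def] using (Real.continuous_cos.tendsto 0).comp hu
  have := ((h2.const_add 1).const_mul (lam / 2)).add_const b
  convert this using 2
  ring

theorem hasDerivAt_mul_mul (H : RadialProfile lam b M u p F) {r : ℝ} (hr : 0 < r) :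
    HasDerivAt (fun x => x * (u x * p x)) (r * p r ^ 2 +
      r * (((M / r ^ 2 + lam) * Real.cos (u r) + b) * (u r * Real.sin (u r)))) r := by
  refine ((hasDerivAt_id r).mul ((H.hasDerivAt r hr).mul (H.hasDerivAt_deriv r hr))).congr_deriv ?_
  simp
  field_simp
  ring

/-- In the oscillatory regime `lam + b < 0`, finite energy forces vanishing Cauchy data. -/
theorem exists_cauchy_data_eq_zero (H : RadialProfile lam b M u p F) (hu : Tendsto u atTop (𝓝 0))
    (hneg : lam + b < 0) : ∃ r, 0 < r ∧ u r = 0 ∧ p r = 0 := by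
  obtain ⟨K, hK⟩ := H.energy_bounded
  have hM := H.nonneg
  set ν := -(lam + b) with hν
  have hν0 : 0 < ν := by linarith
  -- In `2 * M + 1`, the part `2 * M` absorbs `M sin² u ≤ 2 M (1 - cos u)`; the extra `1` leaves `1
  -- - cos u` in the lower bound for `P`, so `P R ≤ 0` forces `u R = 0`.
  have ev : ∀ᶠ r in atTop, 0 < r ∧ |u r| < 1 ∧ 2 * M + 1 ≤ ν * r ^ 2 ∧
      (M / r ^ 2 + lam) * Real.cos (u r) + b < -ν / 2 ∧
      -2 * ν < lam / 2 * (1 + Real.cos (u r)) + b ∧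
      lam / 2 * (1 + Real.cos (u r)) + b < -ν / 2 := by
    have h1 : ∀ᶠ r in atTop, |u r| < 1 := by
      simpa using hu.abs.eventually_lt_const (by simp : |(0 : ℝ)| < 1)
    have h2 : Tendsto (fun r : ℝ => ν * r ^ 2) atTop atTop :=
      (tendsto_pow_atTop two_ne_zero).const_mul_atTop hν0
    filter_upwards [eventually_gt_atTop 0, h1, h2.eventually_ge_atTop (2 * M + 1),
      (tendsto_coefficient lam b M hu).eventually_lt_const (by linarith : lam + b < -ν / 2),
      (tendsto_potential_factor lam b hu).eventually_const_lt (by linarith : -2 * ν < lam + b),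
      (tendsto_potential_factor lam b hu).eventually_lt_const (by linarith : lam + b < -ν / 2)]
      with r a1 a2 a3 a4 a5 a6 using ⟨a1, a2, a3, a4, a5, a6⟩
  obtain ⟨R, hR⟩ := eventually_atTop.1 ev
  have hR0 : 0 < R := (hR R le_rfl).1
  set P := pohozaev lam b M u p with hP
  have hPd : ∀ r, R ≤ r → HasDerivAt P (-4 * r * vortexPotential lam b (u r)) r :=
    fun r hr => H.hasDerivAt_pohozaev (hR0.trans_le hr)
  have hG : ∀ r, R ≤ r → vortexPotential lam b (u r) ≤ -ν / 2 * (1 - Real.cos (u r)) ∧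
      -2 * ν * (1 - Real.cos (u r)) ≤ vortexPotential lam b (u r) := fun r hr => by
    obtain ⟨-, -, -, -, h5, h6⟩ := hR r hr
    have := Real.cos_le_one (u r)
    unfold vortexPotential
    constructor <;> nlinarith
  have hPlow : ∀ r, R ≤ r → (r * p r) ^ 2 + (1 - Real.cos (u r)) ≤ P r := fun r hr => by
    obtain ⟨h1, -, h3, -⟩ := hR r hr
    have h4 := (hG r hr).1
    have h5 : Real.sin (u r) ^ 2 ≤ 2 * (1 - Real.cos (u r)) := by
      nlinarith [Real.sin_sq_add_cos_sq (u r), Real.cos_le_one (u r)]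
    have h6 : r ^ 2 * vortexPotential lam b (u r) ≤ r ^ 2 * (-ν / 2 * (1 - Real.cos (u r))) := by
      gcongr
    have h7 : M * Real.sin (u r) ^ 2 ≤ M * (2 * (1 - Real.cos (u r))) := by gcongr
    have h8 := mul_le_mul_of_nonneg_right h3 (sub_nonneg.2 (Real.cos_le_one (u r)))
    simp only [hP, pohozaev]
    nlinarith
  have hPmono : ∀ r, R ≤ r → P R ≤ P r := fun r hr =>
    le_of_hasDerivAt_nonneg hr (fun x h1 _ => hPd x h1) (fun x h1 _ => by
      have h2 := (hG x h1).1
      have h3 := Real.cos_le_one (u x)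
      have h4 : vortexPotential lam b (u x) ≤ 0 := by nlinarith
      nlinarith [hR0.trans_le h1])
  by_cases hPR : P R ≤ 0
  · refine ⟨R, hR0, ?_, ?_⟩
    · have h1 := hPlow R le_rfl
      have h2 : Real.cos (u R) = 1 :=
        le_antisymm (Real.cos_le_one _) (by nlinarith [sq_nonneg (R * p R)])
      have h3 := abs_lt.1 (hR R le_rfl).2.1
      exact (Real.cos_eq_one_iff_of_lt_of_lt (by linarith [Real.pi_gt_three])
        (by linarith [Real.pi_gt_three])).1 h2
    · have h1 := hPlow R le_rfl
      have h2 : (R * p R) ^ 2 ≤ 0 := by linarith [Real.cos_le_one (u R)]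
      have h3 : R * p R = 0 := pow_eq_zero_iff two_ne_zero |>.1 (le_antisymm h2 (sq_nonneg _))
      exact (mul_eq_zero.1 h3).resolve_left hR0.ne'
  exfalso
  push Not at hPR
  set c₀ := P R with hc₀
  -- `P` grows at least logarithmically
  have hgrow : ∀ r, R ≤ r → F R + P R / 2 - c₀ * Real.log R ≤ F r + P r / 2 - c₀ * Real.log r :=
    fun r hr => le_of_hasDerivAt_nonneg (f := fun x => F x + P x / 2 - c₀ * Real.log x) hr
      (fun x h1 _ => ((H.hasDerivAt_energy x (hR0.trans_le h1)).add ((hPd x h1).div_const 2)).sub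
        ((Real.hasDerivAt_log (hR0.trans_le h1).ne').const_mul c₀)) (fun x h1 _ => by
          have hx := hR0.trans_le h1
          have h2 := hPmono x h1
          have h3 : P x ≤ (x * p x) ^ 2 - 2 * x ^ 2 * vortexPotential lam b (u x) := by
            simp only [hP, pohozaev]
            have : 0 ≤ M * Real.sin (u x) ^ 2 := by positivity
            linarith
          have h4 : 0 ≤ M / x ^ 2 * Real.sin (u x) ^ 2 * x := by positivity
          have h5 : c₀ * x⁻¹ ≤ x * p x ^ 2 - 2 * x * vortexPotential lam b (u x) := by
            rw [← div_eq_mul_inv, div_le_iff₀ hx]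
            nlinarith
          linarith)
  -- the virial quantity `r u u'` is bounded above in terms of `P`
  have hvir : ∀ r, R ≤ r → r * (u r * p r) + P r / 16 - F r ≤ R * (u R * p R) + P R / 16 - F R :=
    fun r hr => le_of_hasDerivAt_nonpos (f := fun x => x * (u x * p x) + P x / 16 - F x) hr
      (fun x h1 _ => ((H.hasDerivAt_mul_mul (hR0.trans_le h1)).add ((hPd x h1).div_const 16)).sub
        (H.hasDerivAt_energy x (hR0.trans_le h1))) (fun x h1 _ => by
          obtain ⟨hx, h2, -, h4, -⟩ := hR x h1
          have h5 : 0 ≤ M / x ^ 2 * Real.sin (u x) ^ 2 * x := by positivity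
          have h6 : 1 - Real.cos (u x) ≤ u x * Real.sin (u x) := by
            refine le_trans ?_ (sin_sq_le_mul_sin h2.le)
            have h7 : 0 ≤ Real.cos (u x) := Real.cos_nonneg_of_mem_Icc
              ⟨by linarith [(abs_lt.1 h2).1, Real.pi_gt_three],
                by linarith [(abs_lt.1 h2).2, Real.pi_gt_three]⟩
            nlinarith [Real.sin_sq_add_cos_sq (u x), Real.cos_le_one (u x)]
          have h8 := (hG x h1).2
          have h9 := Real.cos_le_one (u x)
          have h10 : ((M / x ^ 2 + lam) * Real.cos (u x) + b) * (u x * Real.sin (u x)) ≤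
              -ν / 2 * (1 - Real.cos (u x)) := by nlinarith
          have h11 := mul_le_mul_of_nonneg_left h10 hx.le
          have h12 := mul_le_mul_of_nonneg_left h8 hx.le
          nlinarith)
  -- `F` is bounded, so `P` grows logarithmically and drives `r u u'` to `-∞`. Then `u² + log r` is
  -- nonincreasing, which is absurd.
  have hW : ∃ R₁, R ≤ R₁ ∧ ∀ r, R₁ ≤ r → r * (u r * p r) ≤ -1 := by
    have hlog : Tendsto (fun r => c₀ / 8 * Real.log r) atTop atTop :=
      Real.tendsto_log_atTop.const_mul_atTop (by positivity)
    obtain ⟨R₁, hR₁⟩ := eventually_atTop.1 (hlog.eventually_ge_atTop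
      (1 + (R * (u R * p R) + P R / 16 - F R) + K + K / 8
        - (F R + P R / 2 - c₀ * Real.log R) / 8))
    refine ⟨max R R₁, le_max_left _ _, fun r hr => ?_⟩
    have h1 := hR₁ r ((le_max_right _ _).trans hr)
    have hr' := (le_max_left _ _).trans hr
    have h2 := hgrow r hr'
    have h3 := hvir r hr'
    have h4 := (hK r (hR0.trans_le hr')).2
    linarith
  obtain ⟨R₁, hRR₁, hR₁⟩ := hW
  have hR₁0 := hR0.trans_le hRR₁
  obtain ⟨r, hr1, hr2⟩ := ((Real.tendsto_log_atTop.eventually_gt_atTop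
    (u R₁ ^ 2 + Real.log R₁)).and (eventually_ge_atTop R₁)).exists
  have := le_of_hasDerivAt_nonpos (f := fun x => u x ^ 2 + Real.log x) hr2
    (fun x h1 _ => ((H.hasDerivAt x (hR₁0.trans_le h1)).pow 2).add
      (Real.hasDerivAt_log (hR₁0.trans_le h1).ne')) (fun x h1 _ => by
        have hx := hR₁0.trans_le h1
        have h2 := hR₁ x h1
        have h3 : u x * p x ≤ -x⁻¹ := by
          have := mul_le_mul_of_nonneg_left h2 (inv_pos.2 hx).le
          rw [inv_mul_cancel_left₀ hx.ne'] at this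
          linarith
        have h4 := inv_pos.2 hx
        simp
        nlinarith)
  nlinarith [sq_nonneg (u r)]

/-- In the regime `0 < lam + b` the squared profile decays exponentially. -/
theorem exists_sq_le_exp (H : RadialProfile lam b M u p F) (hu : Tendsto u atTop (𝓝 0))
    (hpos : 0 < lam + b) :
    ∃ C ε R : ℝ, 0 < C ∧ 0 < ε ∧ ∀ r, R ≤ r → u r ^ 2 ≤ C * Real.exp (-ε * r) := by
  set μ := lam + b with hμ
  have ev : ∀ᶠ r in atTop, 0 < r ∧ |u r| < 1 ∧
      μ / 2 < (M / r ^ 2 + lam) * Real.cos (u r) + b := by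
    have h1 : ∀ᶠ r in atTop, |u r| < 1 := by
      simpa using hu.abs.eventually_lt_const (by simp : |(0 : ℝ)| < 1)
    filter_upwards [eventually_gt_atTop 0, h1,
      (tendsto_coefficient lam b M hu).eventually_const_lt (by linarith : μ / 2 < lam + b)]
      with r a1 a2 a3 using ⟨a1, a2, a3⟩
  obtain ⟨R, hR⟩ := eventually_atTop.1 ev
  have hR0 : 0 < R := (hR R le_rfl).1
  have hQ : ∀ r, R ≤ r → μ / 4 * u r ^ 2 ≤
      ((M / r ^ 2 + lam) * Real.cos (u r) + b) * (u r * Real.sin (u r)) := fun r hr => by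
    obtain ⟨-, h2, h3⟩ := hR r hr
    have h4 := half_sq_le_mul_sin h2.le
    nlinarith [sq_nonneg (u r)]
  -- `u²` is eventually nonincreasing
  have hup : ∀ r, R ≤ r → u r * p r ≤ 0 := fun r hr => by
    have hr0 := hR0.trans_le hr
    -- `r u u'` is nondecreasing; once positive, it makes `u²` grow logarithmically, against `|u| <
    -- 1`.
    by_contra! hcon
    set c := r * (u r * p r) with hc
    have hc0 : 0 < c := mul_pos hr0 hcon
    have hmono : ∀ s, r ≤ s → c ≤ s * (u s * p s) := fun s hs =>
      le_of_hasDerivAt_nonneg (f := fun x => x * (u x * p x)) hs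
        (fun x h1 _ => H.hasDerivAt_mul_mul (hr0.trans_le h1)) (fun x h1 _ => by
          have h2 := hQ x (hr.trans h1)
          have h3 := hr0.trans_le h1
          have h4 : 0 ≤ ((M / x ^ 2 + lam) * Real.cos (u x) + b) * (u x * Real.sin (u x)) :=
            le_trans (by positivity) h2
          positivity)
    obtain ⟨s, hs1, hs2⟩ := ((Real.tendsto_log_atTop.eventually_gt_atTop
      (1 / c + Real.log r)).and (eventually_ge_atTop r)).exists
    have h1 := le_of_hasDerivAt_nonneg (f := fun x => u x ^ 2 - c * Real.log x) hs2
      (fun x h1 _ => ((H.hasDerivAt x (hr0.trans_le h1)).pow 2).sub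
        ((Real.hasDerivAt_log (hr0.trans_le h1).ne').const_mul c)) (fun x h1 _ => by
          have hx := hr0.trans_le h1
          have h3 : c * x⁻¹ ≤ u x * p x := by
            rw [← div_eq_mul_inv, div_le_iff₀ hx, mul_comm]
            exact hmono x h1
          have h4 : 0 < c * x⁻¹ := by positivity
          simp
          nlinarith)
    have h2 : u s ^ 2 < 1 := by
      rw [sq_lt_one_iff_abs_lt_one]
      exact (hR s (hr.trans hs2)).2.1
    have h3 : 1 / c < Real.log s - Real.log r := by linarith
    rw [div_lt_iff₀ hc0] at h3
    nlinarith [sq_nonneg (u r)]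
  set ε := min 1 (μ / 2) with hε
  have hε0 : 0 < ε := lt_min one_pos (by linarith)
  have hε1 : ε ^ 2 ≤ μ / 2 := by
    have h1 : ε ≤ 1 := min_le_left _ _
    have h2 : ε ≤ μ / 2 := min_le_right _ _
    nlinarith
  -- With `z = (u²)' + ε u²`, the choice `ε² ≤ μ/2` and `u u' ≤ 0` give `z' ≥ ε z`. A positive value
  -- of `z` would persist, whereas `z ≤ ε u² → 0`.
  have hz : ∀ r, R ≤ r → 2 * (u r * p r) + ε * u r ^ 2 ≤ 0 := fun r hr => by
    have hr0 := hR0.trans_le hr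
    by_contra! hcon
    set z : ℝ → ℝ := fun x => 2 * (u x * p x) + ε * u x ^ 2 with hzdef
    have hexp : ∀ x : ℝ, HasDerivAt (fun x => Real.exp (-ε * x)) (Real.exp (-ε * x) * -ε) x :=
      fun x => by simpa using ((hasDerivAt_id x).const_mul (-ε)).exp
    have hge : ∀ s, r ≤ s → z r ≤ z s := fun s hs => by
      have h1 := le_of_hasDerivAt_nonneg (f := fun x => z x * Real.exp (-ε * x)) hs
        (fun x h1 _ => (((((H.hasDerivAt x (hr0.trans_le h1)).mul
          (H.hasDerivAt_deriv x (hr0.trans_le h1))).const_mul 2).add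
          (((H.hasDerivAt x (hr0.trans_le h1)).pow 2).const_mul ε)).mul (hexp x)))
        (fun x h1 _ => by
          have hx := hr0.trans_le h1
          have h2 := hQ x (hr.trans h1)
          have h3 := hup x (hr.trans h1)
          have h4 := Real.exp_pos (-ε * x)
          have h5 : u x * p x / x ≤ 0 := div_nonpos_of_nonpos_of_nonneg h3 hx.le
          have h6 : ε ^ 2 * u x ^ 2 ≤ μ / 2 * u x ^ 2 := by gcongr
          have h7 : ε * z x ≤ 2 * p x ^ 2 - 2 * (u x * p x / x) +
              2 * (((M / x ^ 2 + lam) * Real.cos (u x) + b) * (u x * Real.sin (u x))) +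
              2 * ε * (u x * p x) := by
            simp only [hzdef]
            nlinarith [sq_nonneg (p x)]
          have h8 := mul_le_mul_of_nonneg_right h7 h4.le
          refine le_of_le_of_eq (sub_nonneg.2 h8) ?_
          simp [hzdef]
          ring)
      have h2 : Real.exp (-ε * s) ≤ Real.exp (-ε * r) := Real.exp_le_exp.2 (by nlinarith)
      have h3 : 0 < z r := hcon
      have h4 : z r * Real.exp (-ε * s) ≤ z s * Real.exp (-ε * s) :=
        (mul_le_mul_of_nonneg_left h2 h3.le).trans h1
      exact le_of_mul_le_mul_right h4 (Real.exp_pos _)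
    have hlim : Tendsto (fun x => ε * u x ^ 2) atTop (𝓝 0) := by
      simpa using (hu.pow 2).const_mul ε
    obtain ⟨s, hs1, hs2⟩ := ((hlim.eventually_lt_const (show (0 : ℝ) < z r from hcon)).and
      (eventually_ge_atTop r)).exists
    have h1 := hge s hs2
    have h2 := hup s (hr.trans hs2)
    have h3 : z s = 2 * (u s * p s) + ε * u s ^ 2 := rfl
    linarith
  refine ⟨(u R ^ 2 + 1) * Real.exp (ε * R), ε, R, by positivity, hε0, fun r hr => ?_⟩
  have hexp : ∀ x : ℝ, HasDerivAt (fun x => Real.exp (ε * x)) (Real.exp (ε * x) * ε) x :=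
    fun x => by simpa using ((hasDerivAt_id x).const_mul ε).exp
  have h1 := le_of_hasDerivAt_nonpos (f := fun x => u x ^ 2 * Real.exp (ε * x)) hr
    (fun x h1 _ => ((H.hasDerivAt x (hR0.trans_le h1)).pow 2).mul (hexp x)) (fun x h1 _ => by
      have h2 := hz x h1
      have h3 := Real.exp_pos (ε * x)
      simp
      nlinarith)
  rw [show -ε * r = -(ε * r) by ring, Real.exp_neg, ← div_eq_mul_inv, le_div_iff₀ (Real.exp_pos _)]
  nlinarith [Real.exp_pos (ε * R)]

end RadialProfile

/-! ### Pohozaev's identity. -/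

theorem abs_vortexPotential_le (lam b x : ℝ) :
    |vortexPotential lam b x| ≤ (1 - Real.cos x) * (|lam| + |b|) := by
  have h1 := Real.cos_le_one x
  have h2 := Real.neg_one_le_cos x
  rw [vortexPotential, abs_mul, abs_of_nonneg (sub_nonneg.2 h1)]
  refine mul_le_mul_of_nonneg_left ((abs_add_le _ _).trans ?_) (sub_nonneg.2 h1)
  rw [abs_mul, abs_div, abs_of_pos (two_pos : (0 : ℝ) < 2),
    abs_of_nonneg (by linarith : 0 ≤ 1 + Real.cos x)]
  nlinarith [abs_nonneg lam]

namespace RadialProfile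

variable {lam b M : ℝ} {u p F : ℝ → ℝ}

/-- The first term on the right is `r F'(r)`, small along sequences tending to `0` and to `∞`
because `F` is bounded. Only `r² G(u)` then needs control: boundedness of `G` suffices at `0`,
exponential decay at `∞`. -/
theorem abs_pohozaev_le (H : RadialProfile lam b M u p F) {r : ℝ} (hr : 0 < r) :
    |pohozaev lam b M u p r| ≤ r * ((p r ^ 2 + M / r ^ 2 * Real.sin (u r) ^ 2) * r) +
      2 * r ^ 2 * |vortexPotential lam b (u r)| := by
  have h1 : r * ((p r ^ 2 + M / r ^ 2 * Real.sin (u r) ^ 2) * r) =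
      (r * p r) ^ 2 + M * Real.sin (u r) ^ 2 := by
    field_simp
  rw [h1, pohozaev]
  have h2 : 0 ≤ M * Real.sin (u r) ^ 2 := mul_nonneg H.nonneg (sq_nonneg _)
  have h3 : 0 ≤ (r * p r) ^ 2 := sq_nonneg _
  have h4 := neg_abs_le (vortexPotential lam b (u r))
  have h5 := le_abs_self (vortexPotential lam b (u r))
  have h6 : 0 ≤ 2 * r ^ 2 := by positivity
  rw [abs_le]
  constructor <;> nlinarith

theorem exists_abs_pohozaev_lt_near_zero (H : RadialProfile lam b M u p F) {η : ℝ} (hη : 0 < η)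
    {δ : ℝ} (hδ : 0 < δ) : ∃ r, 0 < r ∧ r ≤ δ ∧ |pohozaev lam b M u p r| < η := by
  obtain ⟨K, hK⟩ := H.energy_bounded
  have hlim : Tendsto (fun r : ℝ => 2 * r ^ 2 * (2 * (|lam| + |b|))) (𝓝 0) (𝓝 0) :=
    Continuous.tendsto' (by fun_prop) _ _ (by simp)
  obtain ⟨δ', hδ', hδ'η⟩ := Metric.eventually_nhds_iff.1
    (hlim.eventually_lt_const (half_pos hη))
  obtain ⟨r, hr1, hr2, hr3⟩ := exists_le_mul_deriv_lt H.hasDerivAt_energy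
    (fun r hr => (hK r hr).1) (half_pos hη) (lt_min hδ (half_pos hδ'))
  refine ⟨r, hr2, hr1.trans (min_le_left _ _), (H.abs_pohozaev_le hr2).trans_lt ?_⟩
  have h1 := hδ'η (y := r) (by
    rw [Real.dist_eq, sub_zero, abs_of_pos hr2]
    linarith [hr1.trans (min_le_right _ _)])
  have h2 : |vortexPotential lam b (u r)| ≤ 2 * (|lam| + |b|) :=
    (abs_vortexPotential_le lam b (u r)).trans (by
      gcongr
      linarith [Real.neg_one_le_cos (u r)])
  have h3 : 2 * r ^ 2 * |vortexPotential lam b (u r)| ≤ 2 * r ^ 2 * (2 * (|lam| + |b|)) := by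
    gcongr
  linarith

theorem exists_abs_pohozaev_lt_near_top (H : RadialProfile lam b M u p F)
    (hu : Tendsto u atTop (𝓝 0)) (hpos : 0 < lam + b) {η : ℝ} (hη : 0 < η) (R : ℝ) :
    ∃ r, R ≤ r ∧ |pohozaev lam b M u p r| < η := by
  obtain ⟨K, hK⟩ := H.energy_bounded
  obtain ⟨C, ε, R₀, hC, hε, hdecay⟩ := H.exists_sq_le_exp hu hpos
  have hlim : Tendsto (fun r : ℝ => (|lam| + |b|) * C * (r ^ 2 * Real.exp (-ε * r)))
      atTop (𝓝 0) := by
    have := (tendsto_rpow_mul_exp_neg_mul_atTop_nhds_zero 2 ε hε).const_mul ((|lam| + |b|) * C)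
    simpa using this
  obtain ⟨R₁, hR₁⟩ := eventually_atTop.1 (hlim.eventually_lt_const (half_pos hη))
  obtain ⟨r, hr1, hr2, hr3⟩ := exists_ge_mul_deriv_lt H.hasDerivAt_energy
    (fun r hr => (hK r hr).2) (half_pos hη) (max R (max R₀ R₁))
  have hrR₀ : R₀ ≤ r := (le_max_left _ _).trans ((le_max_right _ _).trans hr1)
  have hrR₁ : R₁ ≤ r := (le_max_right _ _).trans ((le_max_right _ _).trans hr1)
  refine ⟨r, (le_max_left _ _).trans hr1, (H.abs_pohozaev_le hr2).trans_lt ?_⟩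
  have h1 := hR₁ r hrR₁
  have h2 : |vortexPotential lam b (u r)| ≤ (C * Real.exp (-ε * r)) / 2 * (|lam| + |b|) :=
    (abs_vortexPotential_le lam b (u r)).trans (by
      gcongr
      linarith [Real.one_sub_sq_div_two_le_cos (x := u r), hdecay r hrR₀])
  have h3 : 2 * r ^ 2 * |vortexPotential lam b (u r)| ≤
      2 * r ^ 2 * ((C * Real.exp (-ε * r)) / 2 * (|lam| + |b|)) := by
    gcongr
  nlinarith

/-- Pohozaev's identity rules out nontrivial profiles with a nonnegative potential. -/
theorem sin_eq_zero (H : RadialProfile lam b M u p F) (hu : Tendsto u atTop (𝓝 0))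
    (hpos : 0 < lam + b) (hb : 0 ≤ b) {r : ℝ} (hr : 0 < r) : Real.sin (u r) = 0 := by
  -- A convex combination of `lam + b` and `b`, hence nonnegative; so the functional is
  -- nonincreasing and, being small near both ends, identically zero.
  have hfac : ∀ x, lam / 2 * (1 + Real.cos x) + b =
      (1 + Real.cos x) / 2 * (lam + b) + (1 - Real.cos x) / 2 * b := fun x => by ring
  have hG : ∀ x, 0 ≤ vortexPotential lam b x := fun x => by
    have h1 := Real.cos_le_one x
    have h2 := Real.neg_one_le_cos x
    rw [vortexPotential, hfac]
    have h3 : 0 ≤ 1 - Real.cos x := by linarith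
    have h4 : 0 ≤ 1 + Real.cos x := by linarith
    positivity
  have hanti : ∀ s t, 0 < s → s ≤ t → pohozaev lam b M u p t ≤ pohozaev lam b M u p s :=
    fun s t hs hst => le_of_hasDerivAt_nonpos hst
      (fun x h1 _ => H.hasDerivAt_pohozaev (hs.trans_le h1)) (fun x h1 _ => by
        have := mul_nonneg (hs.trans_le h1).le (hG (u x))
        linarith)
  have hzero : ∀ s, 0 < s → pohozaev lam b M u p s = 0 := fun s hs => by
    refine le_antisymm (le_of_forall_pos_lt_add fun η hη => ?_)
      (le_of_forall_pos_lt_add fun η hη => ?_)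
    · obtain ⟨t, ht0, hts, ht⟩ := H.exists_abs_pohozaev_lt_near_zero hη hs
      linarith [hanti t s ht0 hts, (abs_lt.1 ht).2]
    · obtain ⟨t, hst, ht⟩ := H.exists_abs_pohozaev_lt_near_top hu hpos hη s
      linarith [hanti s t hs hst, (abs_lt.1 ht).1]
  have hder : -4 * r * vortexPotential lam b (u r) = 0 := by
    refine (H.hasDerivAt_pohozaev hr).unique
      ((hasDerivAt_const r (0 : ℝ)).congr_of_eventuallyEq ?_)
    filter_upwards [Ioi_mem_nhds hr] with x hx using hzero x hx
  have hG0 : vortexPotential lam b (u r) = 0 :=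
    (mul_eq_zero.1 hder).resolve_left (by nlinarith)
  have h1 := Real.cos_le_one (u r)
  have h2 := Real.neg_one_le_cos (u r)
  have h3 := Real.sin_sq_add_cos_sq (u r)
  rw [vortexPotential, hfac] at hG0
  have h4 : Real.cos (u r) = 1 ∨ Real.cos (u r) = -1 := by
    rcases mul_eq_zero.1 hG0 with h | h
    · left; linarith
    · right
      have h5 : 0 ≤ (1 - Real.cos (u r)) / 2 * b := mul_nonneg (by linarith) hb
      nlinarith
  rcases h4 with h4 | h4 <;> rw [h4] at h3 <;> exact pow_eq_zero_iff two_ne_zero |>.1 (by linarith)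

/-- Equipartition in the absence of potential terms. -/
theorem mul_deriv_sq_eq (H : RadialProfile 0 0 M u p F) {r : ℝ} (hr : 0 < r) :
    (r * p r) ^ 2 = M * Real.sin (u r) ^ 2 := by
  have hG : ∀ x, vortexPotential 0 0 x = 0 := fun x => by simp [vortexPotential]
  have hconst : ∀ s, 0 < s → pohozaev 0 0 M u p r = pohozaev 0 0 M u p s := fun s hs =>
    eq_of_hasDerivAt_zero_of_pos (fun x hx => by simpa [hG] using H.hasDerivAt_pohozaev hx) hr hs
  have hzero : |pohozaev 0 0 M u p r| = 0 := by
    refine le_antisymm (le_of_forall_pos_lt_add fun η hη => ?_) (abs_nonneg _)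
    obtain ⟨t, ht0, -, ht⟩ := H.exists_abs_pohozaev_lt_near_zero hη one_pos
    rw [hconst t ht0]
    linarith
  have := abs_eq_zero.1 hzero
  simp only [pohozaev, hG] at this
  linarith

end RadialProfile

/-! ### From solutions of the initial value problem to radial profiles. -/

theorem IsIVPSolution.continuousOn {lam om : ℝ} {m : ℤ} {a : ℝ} {h : ℝ → ℝ}
    (hsol : IsIVPSolution lam om m a h) (hm : m ≠ 0) : ContinuousOn h (Ici 0) := by
  have := hsol.differentiableOn_iteratedDerivWithin 0 (Int.natAbs_pos.2 hm)
  rw [iteratedDerivWithin_zero] at this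
  exact this.continuousOn

theorem IsIVPSolution.ne_zero {lam om : ℝ} {m : ℤ} {a : ℝ} {h : ℝ → ℝ}
    (hsol : IsIVPSolution lam om m a h) (ha : a ≠ 0) : ∃ r, 0 < r ∧ h r ≠ 0 := by
  by_contra! hcon
  refine ha ?_
  rw [← hsol.initial_deriv, iteratedDerivWithin_congr (g := fun _ => (0 : ℝ)) ?_ (by simp)]
  · simp
  · intro x hx
    rcases (mem_Ici.1 hx).eq_or_lt with h0 | h0
    · rw [← h0, hsol.initial_zero]
    · exact hcon x h0

/-- Continuity at `0` and `h 0 = 0` leave only the constant `0`, whose derivatives at `0` all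
vanish, against `a ≠ 0`. -/
theorem IsIVPSolution.not_const {lam om : ℝ} {m : ℤ} {a : ℝ} {h : ℝ → ℝ}
    (hsol : IsIVPSolution lam om m a h) (hm : m ≠ 0) (ha : a ≠ 0) (c : ℝ) :
    ∃ r, 0 < r ∧ h r ≠ c := by
  by_contra! hcon
  have h1 : Tendsto h (𝓝[>] 0) (𝓝 0) := by
    have := (hsol.continuousOn hm 0 self_mem_Ici).mono_left (nhdsWithin_mono 0 Ioi_subset_Ici_self)
    rwa [hsol.initial_zero] at this
  have h2 : Tendsto h (𝓝[>] 0) (𝓝 c) :=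
    tendsto_const_nhds.congr' (by
      filter_upwards [self_mem_nhdsWithin] with x hx using (hcon x hx).symm)
  obtain ⟨r, hr, hr'⟩ := hsol.ne_zero ha
  exact hr' (by rw [hcon r hr, tendsto_nhds_unique h2 h1])

/-- Shifting by `kπ` multiplies `sin` and `cos` by the same sign: their product and `sin²` are
unchanged, and only the `om` term picks up the sign. `F` is the energy on `(0, r)`. -/
theorem IsIVPSolution.radialProfile {lam om : ℝ} {m : ℤ} {a : ℝ} {h : ℝ → ℝ}
    (hsol : IsIVPSolution lam om m a h) (hfin : HasFiniteEnergy m h) (k : ℤ) :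
    ∃ F, RadialProfile lam (Real.cos (k * Real.pi) * om) ((m : ℝ) ^ 2)
      (fun r => h r - k * Real.pi) (deriv h) F := by
  set e : ℝ → ℝ := fun r =>
    ((deriv h r) ^ 2 + (m : ℝ) ^ 2 / r ^ 2 * (Real.sin (h r)) ^ 2) * r with he
  have hint : IntegrableOn e (Ioi 0) := hfin
  have hcont : ContinuousOn e (Ioi 0) := fun r hr => by
    have h1 := (hsol.differentiableAt r hr).continuousAt
    have h2 := (hsol.differentiableAt_deriv r hr).continuousAt
    have h3 : r ^ 2 ≠ 0 := pow_ne_zero 2 (ne_of_gt hr)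
    exact ContinuousAt.continuousWithinAt (by fun_prop (disch := assumption))
  have hnn : ∀ r, 0 ≤ r → 0 ≤ e r := fun r hr => by positivity
  have hσ : Real.cos (k * Real.pi) ^ 2 = 1 := by
    have := Real.sin_sq_add_cos_sq (k * Real.pi)
    rw [Real.sin_int_mul_pi] at this
    linarith
  have hsin : ∀ x, Real.sin (x - k * Real.pi) = Real.cos (k * Real.pi) * Real.sin x := fun x => by
    rw [Real.sin_sub, Real.sin_int_mul_pi]; ring
  have hcos : ∀ x, Real.cos (x - k * Real.pi) = Real.cos (k * Real.pi) * Real.cos x := fun x => by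
    rw [Real.cos_sub, Real.sin_int_mul_pi]; ring
  refine ⟨fun r => ∫ x in (0 : ℝ)..r, e x, sq_nonneg _, fun r hr => ?_, fun r hr => ?_,
    fun r hr => ?_, ∫ x in Ioi 0, e x, fun r hr => ⟨?_, ?_⟩⟩
  · exact (hsol.differentiableAt r hr).hasDerivAt.sub_const _
  · refine (hsol.differentiableAt_deriv r hr).hasDerivAt.congr_deriv ?_
    have := hsol.ode r hr
    simp only [hsin, hcos]
    linear_combination this - (((m : ℝ) ^ 2 / r ^ 2 + lam) * Real.cos (h r) * Real.sin (h r)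
      + om * Real.sin (h r)) * hσ
  · have h1 : IntervalIntegrable e volume 0 r :=
      (intervalIntegrable_iff_integrableOn_Ioc_of_le hr.le).2 (hint.mono_set Ioc_subset_Ioi_self)
    refine (intervalIntegral.integral_hasDerivAt_right h1
      (hcont.stronglyMeasurableAtFilter isOpen_Ioi r hr)
      (hcont.continuousAt (Ioi_mem_nhds hr))).congr_deriv ?_
    simp only [he, hsin, mul_pow, hσ, one_mul]
  · exact intervalIntegral.integral_nonneg hr.le fun x hx => hnn x hx.1
  · rw [intervalIntegral.integral_of_le hr.le]
    refine setIntegral_mono_set hint ?_ (Ioc_subset_Ioi_self.eventuallyLE)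
    filter_upwards [ae_restrict_mem measurableSet_Ioi] with x hx using hnn x (le_of_lt hx)

/-! ### The explicit profile for `lam = om = 0`. -/

/-- In the Leibniz sum at `0`, only the term with all `n` derivatives on `x ^ n` survives. -/
theorem iteratedDeriv_pow_mul_zero (n : ℕ) {g : ℝ → ℝ} (hg : ContDiff ℝ n g) :
    iteratedDeriv n ((fun x => x ^ n) * g) 0 = n.factorial * g 0 := by
  rw [iteratedDeriv_mul (by fun_prop) hg.contDiffAt, Finset.sum_eq_single n]
  · rw [iteratedDeriv_fun_pow_zero]
    simp
  · intro i _ hi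
    rw [iteratedDeriv_fun_pow_zero, if_neg hi]
    simp
  · simp

/-- This identifies the integration constant `C` with `a / (2 n!)`. One differentiation removes the
arctangent, leaving `x ^ (n - 1)` times a smooth factor. -/
theorem iteratedDerivWithin_two_mul_arctan (C : ℝ) {n : ℕ} (hn : n ≠ 0) :
    iteratedDerivWithin n (fun r => 2 * Real.arctan (C * r ^ n)) (Ici 0) 0 =
      2 * C * n.factorial := by
  obtain ⟨j, rfl⟩ := Nat.exists_eq_succ_of_ne_zero hn
  have hsmooth : ContDiff ℝ (j + 1 : ℕ) (fun r : ℝ => 2 * Real.arctan (C * r ^ (j + 1))) :=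
    contDiff_const.mul (ContDiff.arctan (by fun_prop))
  set g : ℝ → ℝ := fun r => 2 * C * (j + 1) / (1 + (C * r ^ (j + 1)) ^ 2) with hg
  have hgs : ContDiff ℝ j g := by
    refine ContDiff.div (by fun_prop) (by fun_prop) fun r => ?_
    positivity
  have hderiv : deriv (fun r : ℝ => 2 * Real.arctan (C * r ^ (j + 1))) = (fun x => x ^ j) * g := by
    ext r
    have h1 := ((((hasDerivAt_id r).pow (j + 1)).const_mul C).arctan.const_mul 2).deriv
    simp only [id, Pi.pow_apply] at h1
    refine h1.trans ?_
    simp [hg]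
    ring
  rw [iteratedDerivWithin_eq_iteratedDeriv (uniqueDiffOn_Ici 0) hsmooth.contDiffAt self_mem_Ici,
    Nat.succ_eq_add_one, iteratedDeriv_succ', hderiv, iteratedDeriv_pow_mul_zero j hgs]
  simp [hg, Nat.factorial_succ]
  ring

/-- Without potential terms the profile is the harmonic map profile. -/
theorem IsIVPSolution.eq_two_mul_arctan {m : ℤ} {a : ℝ} {h : ℝ → ℝ}
    (hsol : IsIVPSolution 0 0 m a h) (hm : m ≠ 0) (ha : a ≠ 0) (hfin : HasFiniteEnergy m h)
    {r : ℝ} (hr : 0 ≤ r) :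
    h r = 2 * Real.arctan (a / (2 * (m.natAbs.factorial : ℝ)) * r ^ m.natAbs) := by
  set n := m.natAbs with hn
  have hn0 : n ≠ 0 := Int.natAbs_ne_zero.2 hm
  have hmn : (m : ℝ) ^ 2 = (n : ℝ) ^ 2 := by
    rw [hn, Nat.cast_natAbs, Int.cast_abs, sq_abs]
  have hcont := hsol.continuousOn hm
  have hder : ∀ x, 0 < x → HasDerivAt h (deriv h x) x := fun x hx =>
    (hsol.differentiableAt x hx).hasDerivAt
  have hsq : ∀ x, 0 < x → (x * deriv h x) ^ 2 = (n * Real.sin (h x)) ^ 2 := fun x hx => by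
    obtain ⟨F, HF⟩ := hsol.radialProfile hfin 0
    simp only [mul_zero] at HF
    have := HF.mul_deriv_sq_eq hx
    simp only [Int.cast_zero, zero_mul, sub_zero] at this
    rw [this, hmn]; ring
  -- At a zero of `sin h`, equipartition also gives `h' = 0`, so uniqueness would make `h` constant.
  have hsin : ∀ x, 0 < x → Real.sin (h x) ≠ 0 := fun x hx h0 => by
    obtain ⟨k, hk⟩ := Real.sin_eq_zero_iff.1 h0
    have hd0 : deriv h x = 0 := by
      have := hsq x hx
      rw [h0, mul_zero, zero_pow two_ne_zero] at this
      exact (mul_eq_zero.1 (pow_eq_zero_iff two_ne_zero |>.1 this)).resolve_left hx.ne'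
    obtain ⟨F, HF⟩ := hsol.radialProfile hfin k
    obtain ⟨s, hs, hs'⟩ := hsol.not_const hm ha (k * Real.pi)
    exact hs' (sub_eq_zero.1 (HF.eq_zero_of_cauchy_data hx (sub_eq_zero.2 hk.symm) hd0 hs))
  have hcos : ∀ x, 0 ≤ x → Real.cos (h x / 2) ≠ 0 := fun x hx h0 => by
    rcases hx.eq_or_lt with rfl | hx
    · simp [hsol.initial_zero] at h0
    · refine hsin x hx ?_
      rw [show h x = 2 * (h x / 2) by ring, Real.sin_two_mul, h0, mul_zero]
  set v : ℝ → ℝ := fun x => Real.tan (h x / 2) with hv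
  have hv0 : Tendsto v (𝓝[>] 0) (𝓝 0) := by
    have h1 : ContinuousWithinAt v (Ici 0) 0 :=
      ContinuousAt.comp_continuousWithinAt (g := Real.tan)
        (Real.continuousAt_tan.2 (hcos 0 le_rfl)) ((hcont 0 self_mem_Ici).div_const 2)
    have h2 := h1.mono_left (nhdsWithin_mono 0 Ioi_subset_Ici_self)
    simpa [hv, hsol.initial_zero] using h2
  have hvd : ∀ x, 0 < x → HasDerivAt v (1 / Real.cos (h x / 2) ^ 2 * (deriv h x / 2)) x :=
    fun x hx => HasDerivAt.comp (h₂ := Real.tan) x (Real.hasDerivAt_tan (hcos x hx.le))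
      ((hder x hx).div_const 2)
  have hvs : ∀ x, 0 < x → Real.sin (h x) / Real.cos (h x / 2) ^ 2 = 2 * v x := fun x hx => by
    have := hcos x hx.le
    have hsin2 : Real.sin (h x) = 2 * Real.sin (h x / 2) * Real.cos (h x / 2) := by
      rw [← Real.sin_two_mul]; ring_nf
    rw [hsin2, show v x = Real.tan (h x / 2) from rfl, Real.tan_eq_sin_div_cos]
    field_simp
  -- No branch jump occurs: the difference has zero derivative and tends to `0` at `0`.
  have hharm : ∀ x, 0 < x → h x = 2 * Real.arctan (v x) := fun x hx => by
    have hd : ∀ y, 0 < y → HasDerivAt (fun y => h y - 2 * Real.arctan (v y)) 0 y := fun y hy => by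
      refine ((hder y hy).sub ((hvd y hy).arctan.const_mul 2)).congr_deriv ?_
      have h1 := hcos y hy.le
      rw [one_div (1 + v y ^ 2), hv, Real.inv_one_add_tan_sq h1]
      field_simp
      ring
    have hlim : Tendsto (fun y => h y - 2 * Real.arctan (v y)) (𝓝[>] 0) (𝓝 0) := by
      have h1 : Tendsto h (𝓝[>] 0) (𝓝 0) := by
        have := (hcont 0 self_mem_Ici).mono_left (nhdsWithin_mono 0 Ioi_subset_Ici_self)
        rwa [hsol.initial_zero] at this
      simpa using h1.sub (((Real.continuous_arctan.tendsto 0).comp hv0).const_mul 2)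
    have hc : Tendsto (fun y => h y - 2 * Real.arctan (v y)) (𝓝[>] 0)
        (𝓝 (h x - 2 * Real.arctan (v x))) :=
      tendsto_const_nhds.congr' (by
        filter_upwards [self_mem_nhdsWithin] with y hy using
          eq_of_hasDerivAt_zero_of_pos hd hx hy)
    exact sub_eq_zero.1 (tendsto_nhds_unique hc hlim)
  have hpow : Tendsto (fun x : ℝ => x ^ n) (𝓝[>] 0) (𝓝 0) :=
    (Continuous.tendsto' (by fun_prop) _ _ (by simp [hn0])).mono_left nhdsWithin_le_nhds
  -- Since `sin h` never vanishes, connectedness of `(0, ∞)` fixes one sign in `r h' = ± n sin h`,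
  -- that is, `r v' = ± n v`.
  have hsgn : EqOn (fun x => x * deriv h x) (fun x => n * Real.sin (h x)) (Ioi 0) ∨
      EqOn (fun x => x * deriv h x) (-fun x => n * Real.sin (h x)) (Ioi 0) := by
    refine isPreconnected_Ioi.eq_or_eq_neg_of_sq_eq ?_ ?_ (fun x hx => hsq x hx) fun {x} hx =>
      mul_ne_zero (Nat.cast_ne_zero.2 hn0) (hsin x hx)
    · exact continuousOn_id.mul fun x hx =>
        (hsol.differentiableAt_deriv x hx).continuousAt.continuousWithinAt
    · exact continuousOn_const.mul
        (Real.continuous_sin.comp_continuousOn (hcont.mono Ioi_subset_Ici_self))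
  have hpd : ∀ x : ℝ, 0 < x → HasDerivAt (fun x => x ^ n) (n * x ^ n / x) x := fun x hx => by
    refine (hasDerivAt_pow n x).congr_deriv ?_
    rw [← Nat.sub_one_add_one hn0, pow_succ]
    field_simp
    simp
  obtain ⟨C, hC⟩ : ∃ C, ∀ x, 0 < x → v x = C * x ^ n := by
    rcases hsgn with hs | hs
    · refine ⟨v 1, fun x hx => ?_⟩
      have h1 : ∀ y, 0 < y → HasDerivAt (fun y => v y / y ^ n) 0 y := fun y hy => by
        have hy' : y ^ n ≠ 0 := pow_ne_zero n hy.ne'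
        refine ((hvd y hy).div (hpd y hy) hy').congr_deriv ?_
        have h2 : deriv h y = n * Real.sin (h y) / y := by
          rw [eq_div_iff hy.ne', mul_comm]; exact hs hy
        have h3 : 1 / Real.cos (h y / 2) ^ 2 * (deriv h y / 2) = n * v y / y := by
          rw [h2]
          linear_combination (n / (2 * y)) * hvs y hy
        rw [h3]
        field_simp
        ring
      have h2 := eq_of_hasDerivAt_zero_of_pos h1 hx one_pos
      simp only [one_pow, div_one] at h2
      rw [← h2, div_mul_cancel₀ _ (pow_ne_zero n hx.ne')]
    -- The minus sign makes `v r ^ n` constant; its limit at `0` is `0`, so `v 1 = 0`, contradicting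
    -- `sin (h 1) ≠ 0`.
    · exfalso
      have h1 : ∀ y, 0 < y → HasDerivAt (fun y => v y * y ^ n) 0 y := fun y hy => by
        refine ((hvd y hy).mul (hpd y hy)).congr_deriv ?_
        have h2 : deriv h y = -(n * Real.sin (h y)) / y := by
          rw [eq_div_iff hy.ne', mul_comm]; exact hs hy
        have h3 : 1 / Real.cos (h y / 2) ^ 2 * (deriv h y / 2) = -(n * v y / y) := by
          rw [h2]
          linear_combination (-n / (2 * y)) * hvs y hy
        rw [h3]
        ring
      have h2 : Tendsto (fun y => v y * y ^ n) (𝓝[>] 0) (𝓝 (v 1 * 1 ^ n)) :=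
        tendsto_const_nhds.congr' (by
          filter_upwards [self_mem_nhdsWithin] with y hy using
            eq_of_hasDerivAt_zero_of_pos h1 one_pos hy)
      have h3 : v 1 = 0 := by
        simpa using tendsto_nhds_unique h2 (hv0.mul hpow)
      have h4 := hvs 1 one_pos
      rw [h3, mul_zero, div_eq_zero_iff] at h4
      exact h4.elim (hsin 1 one_pos) (pow_ne_zero 2 (hcos 1 zero_le_one))
  have hform : EqOn h (fun x => 2 * Real.arctan (C * x ^ n)) (Ici 0) := fun x hx => by
    rcases (mem_Ici.1 hx).eq_or_lt with h0 | h0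
    · simp [← h0, hsol.initial_zero, hn0]
    · simp only [hharm x h0, hC x h0]
  have hCa : a = 2 * C * n.factorial := by
    rw [← hsol.initial_deriv, ← iteratedDerivWithin_two_mul_arctan C hn0]
    exact iteratedDerivWithin_congr hform self_mem_Ici
  have hfac : (n.factorial : ℝ) ≠ 0 := Nat.cast_ne_zero.2 n.factorial_ne_zero
  rw [hform hr, hCa]
  field_simp

/-! ### The classification. -/

theorem theorem1 (lam om : ℝ) (m : ℤ) (hm : m ≠ 0) (a : ℝ) (ha : a ≠ 0) (h : ℝ → ℝ)
    (hsol : IsVortexSolution lam om m a h) (hfin : HasFiniteEnergy m h) :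
    ∃! i : Fin 5,
      ![(lam = 0 ∧ om = 0) ∧
          ∀ r : ℝ, 0 ≤ r →
            h r = 2 * Real.arctan (a / (2 * (m.natAbs.factorial : ℝ)) * r ^ m.natAbs),
        (lam = om ∧ om ≠ 0) ∧ ∃ l : ℤ, Tendsto h atTop (𝓝 ((2 * (l : ℝ) + 1) * Real.pi)),
        (lam = -om ∧ om ≠ 0) ∧ ∃ l : ℤ, Tendsto h atTop (𝓝 (2 * (l : ℝ) * Real.pi)),
        (0 < om ∧ om < lam) ∧
          ∃ l : ℤ, ConvergesExponentially h ((2 * (l : ℝ) + 1) * Real.pi),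
        (-lam < om ∧ om < 0) ∧
          ∃ l : ℤ, ConvergesExponentially h (2 * (l : ℝ) * Real.pi)] i := by
  have hivp := hsol.toIsIVPSolution
  refine existsUnique_of_exists_of_unique ?_ ?_
  · obtain ⟨k, hk⟩ := hsol.limit
    obtain ⟨F, HF⟩ := hivp.radialProfile hfin k
    have hu : Tendsto (fun r => h r - k * Real.pi) atTop (𝓝 0) := by
      simpa using hk.sub_const (k * Real.pi)
    set b := Real.cos (k * Real.pi) * om with hb
    have hnonneg : 0 ≤ lam + b := by
      by_contra! hneg
      obtain ⟨r, hr, hr1, hr2⟩ := HF.exists_cauchy_data_eq_zero hu hneg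
      obtain ⟨s, hs, hs'⟩ := hivp.not_const hm ha (k * Real.pi)
      exact hs' (sub_eq_zero.1 (HF.eq_zero_of_cauchy_data hr hr1 hr2 hs))
    have hbneg : 0 < lam + b → b < 0 := fun hpos => by
      by_contra! hb0
      have hsin : ∀ r, 0 < r → Real.sin (h r) = 0 := fun r hr => by
        have := HF.sin_eq_zero hu hpos hb0 hr
        rw [Real.sin_sub_int_mul_pi] at this
        exact (mul_eq_zero.1 this).resolve_left (zpow_ne_zero k (by norm_num))
      have hd : ∀ r, 0 < r → HasDerivAt h 0 r := fun r hr => by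
        have h1 := (hivp.differentiableAt r hr).hasDerivAt
        have h2 : Real.cos (h r) * deriv h r = 0 := h1.sin.unique
          ((hasDerivAt_const r (0 : ℝ)).congr_of_eventuallyEq (by
            filter_upwards [Ioi_mem_nhds hr] with x hx using hsin x hx))
        have h3 : Real.cos (h r) ≠ 0 := fun h0 => by
          have := Real.sin_sq_add_cos_sq (h r)
          rw [hsin r hr, h0] at this
          norm_num at this
        rwa [(mul_eq_zero.1 h2).resolve_left h3] at h1
      obtain ⟨s, hs, hs'⟩ := hivp.not_const hm ha (h 1)
      exact hs' (eq_of_hasDerivAt_zero_of_pos hd hs one_pos)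
    have hexp : 0 < lam + b → ConvergesExponentially h (k * Real.pi) := fun hpos => by
      obtain ⟨C, ε, R, hC, hε, hdecay⟩ := HF.exists_sq_le_exp hu hpos
      refine ⟨Real.sqrt C, ε / 2, R, Real.sqrt_pos.2 hC, half_pos hε, fun r hr => ?_⟩
      refine abs_le_of_sq_le_sq ?_ (by positivity)
      rw [mul_pow, Real.sq_sqrt hC.le, ← Real.exp_nat_mul]
      refine (hdecay r hr).trans (le_of_eq ?_)
      congr 2
      push_cast
      ring
    by_cases h0 : lam = 0 ∧ om = 0
    · refine ⟨0, h0, fun r hr => ?_⟩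
      obtain ⟨rfl, rfl⟩ := h0
      exact hivp.eq_two_mul_arctan hm ha hfin hr
    -- The parity of `k` decides `b = om` or `b = -om`; within each, `lam + b` zero or positive
    -- picks the case.
    rcases Int.even_or_odd' k with ⟨l, hl | hl⟩
    · have hkl : (k : ℝ) * Real.pi = 2 * (l : ℝ) * Real.pi := by rw [hl]; push_cast; ring
      have hbom : b = om := by
        rw [hb, hkl, show 2 * (l : ℝ) * Real.pi = l * (2 * Real.pi) by ring,
          Real.cos_int_mul_two_pi, one_mul]
      rw [hkl] at hk hexp
      rw [hbom] at hnonneg hbneg hexp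
      rcases hnonneg.eq_or_lt with h1 | h1
      · exact ⟨2, ⟨by linarith, fun h2 => h0 ⟨by linarith, h2⟩⟩, l, hk⟩
      · exact ⟨4, ⟨by linarith, hbneg h1⟩, l, hexp h1⟩
    · have hkl : (k : ℝ) * Real.pi = (2 * (l : ℝ) + 1) * Real.pi := by rw [hl]; push_cast; ring
      have hbom : b = -om := by
        rw [hb, hkl, show (2 * (l : ℝ) + 1) * Real.pi = l * (2 * Real.pi) + Real.pi by ring,
          Real.cos_int_mul_two_pi_add_pi, neg_one_mul]
      rw [hkl] at hk hexp
      rw [hbom] at hnonneg hbneg hexp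
      rcases hnonneg.eq_or_lt with h1 | h1
      · exact ⟨1, ⟨by linarith, fun h2 => h0 ⟨by linarith, h2⟩⟩, l, hk⟩
      · exact ⟨3, ⟨by linarith [hbneg h1], by linarith⟩, l, hexp h1⟩
  -- The conditions on the parameters alone are mutually exclusive.
  · intro i j hi hj
    fin_cases i <;> fin_cases j <;> first
      | rfl
      | (exfalso
         obtain ⟨⟨h1, h2⟩, -⟩ := hi
         obtain ⟨⟨h3, h4⟩, -⟩ := hj
         first
           | linarith
           | exact h4 (by linarith)
           | exact h2 (by linarith))
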